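/- For integers $q,t$ consider the Weierstrass curves over $\mathbb{Q}$ $$E_{q,t}:\ y^2=x^3+q^2x^2+3q^3x+3q^6t,\qquad H_{q,t}:\ y^2=x^3+q(27-2q-81qt)x^2+q(q-9)^3x.$$ Suppose that $(q,t)\neq(12,0)$ and that one of the following holds: (i) $q\equiv 3\pmod 4$ and $t\equiv 3\pmod 4$; (ii) $q$ is congruent to $1$, $5$ or $13$ modulo $16$, and $t\equiv 1\pmod 8$; (iii) $q\in\{8,10,12\}$ (and $t\in\mathbb{Z}$ is arbitrary). Then $E_{q,t}$ and $H_{q,t}$ are elliptic curves (that is, nonsingular), and neither of them has Kodaira type $\mathrm{II}$, $\mathrm{II}^*$, $\mathrm{IV}$ or $\mathrm{IV}^*$ at the prime $2$. Here the Kodaira type at $2$ is the one that Tate's algorithm assigns to the curve over $\mathbb{Q}_2$. -/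

import Mathlib

/-- The Kodaira symbols `I_n` (`n ≥ 0`), `II`, `III`, `IV`, `I_n^*` (`n ≥ 0`), `IV^*`, `III^*`,
`II^*`. -/
inductive KodairaType : Type
  | I (n : ℕ)
  | II
  | III
  | IV
  | Istar (n : ℕ)
  | IVstar
  | IIIstar
  | IIstar

/-- The discriminant of the monic cubic `x³ + a x² + b x + c`. -/
def monicCubicDisc {R : Type*} [CommRing R] (a b c : R) : R :=
  a ^ 2 * b ^ 2 - 4 * b ^ 3 - 4 * a ^ 3 * c - 27 * c ^ 2 + 18 * a * b * c

/-- `TateStops p W T`: the `p`-adically integral Weierstrass equation `W` is, with no further change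
of variables, in the position in which Tate's algorithm stops with output `T`.

Write `a_{i,k} = a_i / p^k`. All conditions on roots of auxiliary polynomials over the residue field
are expressed by their discriminants:
* `T³ + a_{2,1} T² + a_{4,2} T + a_{6,3}` has distinct roots mod `p` iff the discriminant of
  `x³ + a₂ x² + a₄ x + a₆` is not divisible by `p ^ 7`;
* `Y² + a_{3,k} Y - a_{6,2k}` has distinct roots mod `p` iff `b₆ = a₃² + 4 a₆` is not divisible by
  `p ^ (2 k + 1)`;
* `a_{2,1} X² + a_{4,k+1} X + a_{6,2k+1}` has distinct roots mod `p` iff `a₄² - 4 a₂ a₆` is not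
  divisible by `p ^ (2 k + 3)`.

In the cases `I_n^*` with `n ≥ 1`, the double root of the cubic has been moved to `0`, and so have
the double roots of the quadratics met in the preceding stages of the subprocedure; in the cases
`IV^*`, `III^*`, `II^*` the triple root of the cubic has been moved to `0`, and in the last two so
has the double root of `Y² + a_{3,2} Y - a_{6,4}`. -/
def TateStops (p : ℕ) [Fact p.Prime] (W : WeierstrassCurve ℤ_[p]) : KodairaType → Prop
  | .I 0 => ¬ (p : ℤ_[p]) ∣ W.Δ
  | .I (n + 1) =>
      (p : ℤ_[p]) ∣ W.a₃ ∧ (p : ℤ_[p]) ∣ W.a₄ ∧ (p : ℤ_[p]) ∣ W.a₆ ∧ ¬ (p : ℤ_[p]) ∣ W.b₂ ∧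
        (p : ℤ_[p]) ^ (n + 1) ∣ W.Δ ∧ ¬ (p : ℤ_[p]) ^ (n + 2) ∣ W.Δ
  | .II =>
      (p : ℤ_[p]) ∣ W.a₃ ∧ (p : ℤ_[p]) ∣ W.a₄ ∧ (p : ℤ_[p]) ∣ W.a₆ ∧ (p : ℤ_[p]) ∣ W.b₂ ∧
        ¬ (p : ℤ_[p]) ^ 2 ∣ W.a₆
  | .III =>
      (p : ℤ_[p]) ∣ W.a₃ ∧ (p : ℤ_[p]) ∣ W.a₄ ∧ (p : ℤ_[p]) ^ 2 ∣ W.a₆ ∧ (p : ℤ_[p]) ∣ W.b₂ ∧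
        ¬ (p : ℤ_[p]) ^ 3 ∣ W.b₈
  | .IV =>
      (p : ℤ_[p]) ∣ W.a₃ ∧ (p : ℤ_[p]) ∣ W.a₄ ∧ (p : ℤ_[p]) ^ 2 ∣ W.a₆ ∧ (p : ℤ_[p]) ∣ W.b₂ ∧
        (p : ℤ_[p]) ^ 3 ∣ W.b₈ ∧ ¬ (p : ℤ_[p]) ^ 3 ∣ W.b₆
  | .Istar 0 =>
      (p : ℤ_[p]) ∣ W.a₁ ∧ (p : ℤ_[p]) ∣ W.a₂ ∧ (p : ℤ_[p]) ^ 2 ∣ W.a₃ ∧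
        (p : ℤ_[p]) ^ 2 ∣ W.a₄ ∧ (p : ℤ_[p]) ^ 3 ∣ W.a₆ ∧
        ¬ (p : ℤ_[p]) ^ 7 ∣ monicCubicDisc W.a₂ W.a₄ W.a₆
  | .Istar (n + 1) =>
      (p : ℤ_[p]) ∣ W.a₁ ∧ (p : ℤ_[p]) ∣ W.a₂ ∧ ¬ (p : ℤ_[p]) ^ 2 ∣ W.a₂ ∧
        ((∃ m : ℕ, 1 ≤ m ∧ n + 1 = 2 * m - 1 ∧
            (p : ℤ_[p]) ^ (m + 1) ∣ W.a₃ ∧ (p : ℤ_[p]) ^ (m + 2) ∣ W.a₄ ∧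
            (p : ℤ_[p]) ^ (2 * m + 2) ∣ W.a₆ ∧ ¬ (p : ℤ_[p]) ^ (2 * m + 3) ∣ W.b₆) ∨
         (∃ m : ℕ, 1 ≤ m ∧ n + 1 = 2 * m ∧
            (p : ℤ_[p]) ^ (m + 2) ∣ W.a₃ ∧ (p : ℤ_[p]) ^ (m + 2) ∣ W.a₄ ∧
            (p : ℤ_[p]) ^ (2 * m + 3) ∣ W.a₆ ∧
            ¬ (p : ℤ_[p]) ^ (2 * m + 5) ∣ W.a₄ ^ 2 - 4 * W.a₂ * W.a₆))
  | .IVstar =>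
      (p : ℤ_[p]) ∣ W.a₁ ∧ (p : ℤ_[p]) ^ 2 ∣ W.a₂ ∧ (p : ℤ_[p]) ^ 2 ∣ W.a₃ ∧
        (p : ℤ_[p]) ^ 3 ∣ W.a₄ ∧ (p : ℤ_[p]) ^ 4 ∣ W.a₆ ∧ ¬ (p : ℤ_[p]) ^ 5 ∣ W.b₆
  | .IIIstar =>
      (p : ℤ_[p]) ∣ W.a₁ ∧ (p : ℤ_[p]) ^ 2 ∣ W.a₂ ∧ (p : ℤ_[p]) ^ 3 ∣ W.a₃ ∧
        (p : ℤ_[p]) ^ 3 ∣ W.a₄ ∧ (p : ℤ_[p]) ^ 5 ∣ W.a₆ ∧ ¬ (p : ℤ_[p]) ^ 4 ∣ W.a₄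
  | .IIstar =>
      (p : ℤ_[p]) ∣ W.a₁ ∧ (p : ℤ_[p]) ^ 2 ∣ W.a₂ ∧ (p : ℤ_[p]) ^ 3 ∣ W.a₃ ∧
        (p : ℤ_[p]) ^ 4 ∣ W.a₄ ∧ (p : ℤ_[p]) ^ 5 ∣ W.a₆ ∧ ¬ (p : ℤ_[p]) ^ 6 ∣ W.a₆

/-- The elliptic curve `W` over `ℚ` has Kodaira type `T` at the prime `p`, in the sense of Tate's
algorithm: some `p`-adically integral Weierstrass equation isomorphic to `W` over `ℚ_p` is in the
position in which the algorithm stops with output `T`. -/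
def HasKodairaTypeAt (W : WeierstrassCurve ℚ) (p : ℕ) [Fact p.Prime] (T : KodairaType) : Prop :=
  ∃ (C : WeierstrassCurve.VariableChange ℚ_[p]) (W' : WeierstrassCurve ℤ_[p]),
    C • W.map (algebraMap ℚ ℚ_[p]) = W'.map (algebraMap ℤ_[p] ℚ_[p]) ∧ TateStops p W' T

/-- The curve `E_{q,t} : y² = x³ + q² x² + 3 q³ x + 3 q⁶ t` over `ℚ`. -/
def curveE (q t : ℤ) : WeierstrassCurve ℚ where
  a₁ := 0
  a₂ := (q : ℚ) ^ 2
  a₃ := 0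
  a₄ := 3 * (q : ℚ) ^ 3
  a₆ := 3 * (q : ℚ) ^ 6 * t

/-- The curve `H_{q,t} : y² = x³ + q (27 - 2 q - 81 q t) x² + q (q - 9)³ x` over `ℚ`. -/
def curveH (q t : ℤ) : WeierstrassCurve ℚ where
  a₁ := 0
  a₂ := (q : ℚ) * (27 - 2 * q - 81 * q * t)
  a₃ := 0
  a₄ := (q : ℚ) * ((q : ℚ) - 9) ^ 3
  a₆ := 0

/-!
Tate's algorithm at `2` stops with type `II`, `IV`, `IV*` or `II*` only on equations with `a₁` and
`a₃` even. Completing the square keeps such an equation integral and produces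
`y² = x³ + A₂ x² + A₄ x + A₆` whose coefficients satisfy explicit congruences modulo powers of `2`
(`IsExceptional`, `TateStops.exists_isExceptional`). Both `E` and `H` are already of the shape
`y² = f(x)` with `f` monic and integral, so a model of exceptional type amounts to some `u ≠ 0` and
`r` in `ℚ₂` for which `u⁻⁶ f(u² x + r)` has exceptional coefficients. An exceptional cubic is
minimal (`not_isExceptional_of_scaled`), so `u` is integral, and then `r` is integral because `3` is
a `2`-adic unit. The unit part of `u` does not affect the congruences, so one may take `u = 2 ^ k`:
this is `HasExceptionalModel`, obtained in `hasExceptionalModel_of_hasKodairaTypeAt`.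

Minimality also shows that `f` may be replaced by any integral rescaling of itself
(`HasExceptionalModel.of_scaled`). After the evident rescalings, `k ≥ 1` would force the three
coefficients of a translate of `f` to be divisible by `4`, `16` and `64`. This and the case `k = 0`
are excluded by congruences modulo `16` (`HasExceptionalModel.mod`), checked over all residues, or,
when the linear coefficient is `2` modulo `4` and the constant one is divisible by `4`, by
`not_hasExceptionalModel_of_two_mul_odd`.

For nonsingularity, both discriminants are, up to powers of `q` and `q - 9` and a nonzero constant,
a quadratic polynomial in `t` of discriminant `16 (q (q - 9))³` (`discFactor_ne_zero`). Either this
has odd `2`-adic valuation and so is no square, or the quadratic does not vanish modulo `32`, or `q`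
is `8`, `10` or `12` and the claim is immediate.
-/

/-! ### Arithmetic of the `2`-adic integers -/

lemma PadicInt.two_prime : Prime (2 : ℤ_[2]) := by
  simpa using PadicInt.prime_p (p := 2)

lemma PadicInt.even_or_odd (x : ℤ_[2]) : (∃ y, x = 2 * y) ∨ ∃ y, x = 2 * y + 1 := by
  have h := PadicInt.sub_zmodRepr_mem (p := 2) x
  rw [PadicInt.maximalIdeal_eq_span_p, Ideal.mem_span_singleton] at h
  have hlt := PadicInt.zmodRepr_lt_p (p := 2) x
  obtain ⟨y, hy⟩ := h
  generalize x.zmodRepr = n at hy hlt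
  interval_cases n
  · exact Or.inl ⟨y, by simpa using hy⟩
  · exact Or.inr ⟨y, by push_cast at hy; linear_combination hy⟩

/-- A nonzero multiple of an odd `2`-adic integer does not vanish. -/
lemma PadicInt.mul_odd_ne_zero {m : ℤ_[2]} (hm : m ≠ 0) (x : ℤ_[2]) : m * (2 * x + 1) ≠ 0 :=
  mul_ne_zero hm fun h => PadicInt.two_prime.not_isUnit
    (isUnit_of_dvd_one ⟨-x, by linear_combination h⟩)

lemma PadicInt.isUnit_three : IsUnit (3 : ℤ_[2]) := by
  by_contra h
  have h2 : (2 : ℤ_[2]) ∣ 3 := by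
    have := (PadicInt.norm_lt_one_iff_dvd (p := 2) 3).1 (PadicInt.not_isUnit_iff.1 h)
    simpa using this
  refine PadicInt.two_prime.not_isUnit (isUnit_of_dvd_one ?_)
  simpa using dvd_sub h2 (dvd_refl (2 : ℤ_[2])) |>.trans (by norm_num)

/-- The square of a `2`-adic unit is `1` modulo `8`. -/
lemma PadicInt.exists_sq_unit_eq (w : ℤ_[2]ˣ) : ∃ x, (w : ℤ_[2]) ^ 2 = 1 + 8 * x := by
  rcases PadicInt.even_or_odd w with ⟨y, hy⟩ | ⟨y, hy⟩
  · exact absurd (isUnit_of_dvd_unit ⟨y, hy⟩ w.isUnit) PadicInt.two_prime.not_isUnit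
  · rw [hy]
    rcases PadicInt.even_or_odd y with ⟨z, rfl⟩ | ⟨z, rfl⟩
    · exact ⟨2 * z ^ 2 + z, by ring⟩
    · exact ⟨2 * z ^ 2 + 3 * z + 1, by ring⟩

/-! ### Models of the exceptional types with `a₁ = a₃ = 0` -/

/-- Congruences satisfied by the coefficients of `y² = x³ + A₂ x² + A₄ x + A₆`, after completing the
square, when a `2`-adically integral equation is in the final position of Tate's algorithm for one
of the types `II` (`A₆` is `2` or `3` modulo `4`), `IV` (`A₆` is `1` modulo `4`), `IV*` and `II*`
(the last two alternatives). -/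
def IsExceptional (A₂ A₄ A₆ : ℤ_[2]) : Prop :=
  2 ∣ A₄ ∧ (4 ∣ A₆ - 1 ∨ 4 ∣ A₆ - 2 ∨ 4 ∣ A₆ - 3 ∨
    (16 ∣ A₆ - 4 ∧ (4 ∣ A₂ ∧ 8 ∣ A₄ ∨ 4 ∣ A₂ - 1 ∧ 8 ∣ A₄ - 4)) ∨
    ((4 ∣ A₂ ∧ 16 ∣ A₄ ∨ 4 ∣ A₂ - 1 ∧ 8 ∣ A₄) ∧ (64 ∣ A₆ - 32 ∨ 64 ∣ A₆ - 48)))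

/-- All four types force `a₁` and `a₃` to be even, so that completing the square stays integral. -/
lemma TateStops.exists_isExceptional {W : WeierstrassCurve ℤ_[2]}
    (h : TateStops 2 W .II ∨ TateStops 2 W .IIstar ∨ TateStops 2 W .IV ∨ TateStops 2 W .IVstar) :
    ∃ α β, W.a₁ = 2 * α ∧ W.a₃ = 2 * β ∧
      IsExceptional (W.a₂ + α ^ 2) (W.a₄ + 2 * α * β) (W.a₆ + β ^ 2) := by
  have even_a₁ : (2 : ℤ_[2]) ∣ W.b₂ → (2 : ℤ_[2]) ∣ W.a₁ := fun hb => by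
    refine PadicInt.two_prime.dvd_of_dvd_pow (n := 2) ?_
    rw [WeierstrassCurve.b₂] at hb
    exact (dvd_add_left ⟨2 * W.a₂, by ring⟩).1 hb
  rcases h with h | h | h | h <;> simp only [TateStops, Nat.cast_ofNat] at h
  · obtain ⟨⟨β, h3⟩, ⟨e, h4⟩, ⟨f, h6⟩, hb, hn⟩ := h
    obtain ⟨α, h1⟩ := even_a₁ hb
    refine ⟨α, β, h1, h3, ⟨e + α * β, by rw [h4]; ring⟩, ?_⟩
    rcases PadicInt.even_or_odd f with ⟨f, rfl⟩ | ⟨f, rfl⟩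
    · exact absurd ⟨f, by rw [h6]; ring⟩ hn
    rcases PadicInt.even_or_odd β with ⟨γ, rfl⟩ | ⟨γ, rfl⟩
    · exact Or.inr (Or.inl ⟨f + γ ^ 2, by rw [h6]; ring⟩)
    · exact Or.inr (Or.inr (Or.inl ⟨f + γ ^ 2 + γ, by rw [h6]; ring⟩))
  · obtain ⟨⟨α, h1⟩, ⟨d, h2⟩, ⟨γ, h3⟩, ⟨e, h4⟩, ⟨f, h6⟩, hn⟩ := h
    refine ⟨α, 4 * γ, h1, by rw [h3]; ring, ⟨8 * e + 4 * α * γ, by rw [h4]; ring⟩,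
      Or.inr (Or.inr (Or.inr (Or.inr ⟨?_, ?_⟩)))⟩
    · rcases PadicInt.even_or_odd α with ⟨α, rfl⟩ | ⟨α, rfl⟩
      · exact Or.inl ⟨⟨d + α ^ 2, by rw [h2]; ring⟩, ⟨e + α * γ, by rw [h4]; ring⟩⟩
      · exact Or.inr ⟨⟨d + α ^ 2 + α, by rw [h2]; ring⟩,
          ⟨2 * e + (2 * α + 1) * γ, by rw [h4]; ring⟩⟩
    · rcases PadicInt.even_or_odd f with ⟨f, rfl⟩ | ⟨f, rfl⟩
      · exact absurd ⟨f, by rw [h6]; ring⟩ hn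
      rcases PadicInt.even_or_odd γ with ⟨γ, rfl⟩ | ⟨γ, rfl⟩
      · exact Or.inl ⟨f + γ ^ 2, by rw [h6]; ring⟩
      · exact Or.inr ⟨f + γ ^ 2 + γ, by rw [h6]; ring⟩
  · obtain ⟨⟨β, h3⟩, ⟨e, h4⟩, ⟨f, h6⟩, hb, -, hn⟩ := h
    obtain ⟨α, h1⟩ := even_a₁ hb
    refine ⟨α, β, h1, h3, ⟨e + α * β, by rw [h4]; ring⟩, Or.inl ?_⟩
    rcases PadicInt.even_or_odd β with ⟨γ, rfl⟩ | ⟨γ, rfl⟩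
    · exact absurd ⟨2 * (γ ^ 2 + f), by rw [WeierstrassCurve.b₆, h3, h6]; ring⟩ hn
    · exact ⟨f + γ ^ 2 + γ, by rw [h6]; ring⟩
  · obtain ⟨⟨α, h1⟩, ⟨d, h2⟩, ⟨γ, h3⟩, ⟨e, h4⟩, ⟨f, h6⟩, hn⟩ := h
    refine ⟨α, 2 * γ, h1, by rw [h3]; ring, ⟨4 * e + 2 * α * γ, by rw [h4]; ring⟩,
      Or.inr (Or.inr (Or.inr (Or.inl ?_)))⟩
    rcases PadicInt.even_or_odd γ with ⟨γ, rfl⟩ | ⟨γ, rfl⟩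
    · exact absurd ⟨2 * (γ ^ 2 + f), by rw [WeierstrassCurve.b₆, h3, h6]; ring⟩ hn
    refine ⟨⟨f + γ ^ 2 + γ, by rw [h6]; ring⟩, ?_⟩
    rcases PadicInt.even_or_odd α with ⟨α, rfl⟩ | ⟨α, rfl⟩
    · exact Or.inl ⟨⟨d + α ^ 2, by rw [h2]; ring⟩, ⟨e + α * (2 * γ + 1), by rw [h4]; ring⟩⟩
    · exact Or.inr ⟨⟨d + α ^ 2 + α, by rw [h2]; ring⟩,
        ⟨e + 2 * α * γ + α + γ, by rw [h4]; ring⟩⟩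

lemma IsExceptional.unit_scale {A₂ A₄ A₆ : ℤ_[2]} (h : IsExceptional A₂ A₄ A₆) (w : ℤ_[2]ˣ) :
    IsExceptional (w ^ 2 * A₂) (w ^ 4 * A₄) (w ^ 6 * A₆) := by
  obtain ⟨x, hx⟩ := PadicInt.exists_sq_unit_eq w
  -- `w ^ 4` and `w ^ 6` are `1` modulo `8` as well, so every congruence below is preserved
  obtain ⟨y, hy⟩ : ∃ y, (w : ℤ_[2]) ^ 4 = 1 + 8 * y :=
    ⟨2 * x + 8 * x ^ 2, by linear_combination ((w : ℤ_[2]) ^ 2 + 1 + 8 * x) * hx⟩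
  obtain ⟨z, hz⟩ : ∃ z, (w : ℤ_[2]) ^ 6 = 1 + 8 * z :=
    ⟨x + y + 8 * x * y, by linear_combination (w : ℤ_[2]) ^ 4 * hx + (1 + 8 * x) * hy⟩
  rw [hx, hy, hz]
  have key : ∀ {m d e : ℤ_[2]} (u A : ℤ_[2]), m ∣ A - d → 8 * d = m * e →
      m ∣ (1 + 8 * u) * A - d := by
    rintro m d e u A ⟨k, hk⟩ he
    exact ⟨(1 + 8 * u) * k + u * e, by linear_combination (1 + 8 * u) * hk + u * he⟩
  obtain ⟨h2, h⟩ := h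
  refine ⟨h2.mul_left _, ?_⟩
  rcases h with h | h | h | ⟨h, h' | h'⟩ | ⟨h, h'⟩
  · exact Or.inl (key (e := 2) _ _ h (by norm_num))
  · exact Or.inr (Or.inl (key (e := 4) _ _ h (by norm_num)))
  · exact Or.inr (Or.inr (Or.inl (key (e := 6) _ _ h (by norm_num))))
  · exact Or.inr (Or.inr (Or.inr (Or.inl
      ⟨key (e := 2) _ _ h (by norm_num),
        Or.inl ⟨h'.1.mul_left _, h'.2.mul_left _⟩⟩)))
  · exact Or.inr (Or.inr (Or.inr (Or.inl
      ⟨key (e := 2) _ _ h (by norm_num),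
        Or.inr ⟨key (e := 2) _ _ h'.1 (by norm_num),
          key (e := 4) _ _ h'.2 (by norm_num)⟩⟩)))
  · refine Or.inr (Or.inr (Or.inr (Or.inr ⟨?_, ?_⟩)))
    · exact h.imp (fun h => ⟨h.1.mul_left _, h.2.mul_left _⟩)
        (fun h => ⟨key (e := 2) _ _ h.1 (by norm_num), h.2.mul_left _⟩)
    · exact h'.imp (fun h => key (e := 4) _ _ h (by norm_num))
        (fun h => key (e := 6) _ _ h (by norm_num))

/-- A translate of an integral cubic rescaled by `x ↦ 4 x` is never exceptional: this is the
minimality of the models in which Tate's algorithm stops with an exceptional type. -/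
lemma not_isExceptional_of_scaled (a b c r : ℤ_[2]) :
    ¬ IsExceptional (3 * r + 4 * a) (3 * r ^ 2 + 8 * a * r + 16 * b)
      (r ^ 3 + 4 * a * r ^ 2 + 16 * b * r + 64 * c) := by
  rintro ⟨⟨e, h2⟩, h⟩
  rcases PadicInt.even_or_odd r with ⟨s, rfl⟩ | ⟨s, rfl⟩
  swap
  · exact PadicInt.mul_odd_ne_zero one_ne_zero
      (6 * s ^ 2 + 6 * s + 1 + 4 * a * (2 * s + 1) + 8 * b - e) (by linear_combination h2)
  -- `r = 2 s` makes the constant coefficient divisible by `8`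
  set z := s ^ 3 + 2 * a * s ^ 2 + 4 * b * s + 8 * c with hz
  have h6 : (2 * s) ^ 3 + 4 * a * (2 * s) ^ 2 + 16 * b * (2 * s) + 64 * c = 8 * z := by
    rw [hz]; ring
  rw [h6] at h
  rcases h with ⟨k, h⟩ | ⟨k, h⟩ | ⟨k, h⟩ | ⟨⟨k, h⟩, -⟩ | ⟨h4, h⟩
  · exact PadicInt.mul_odd_ne_zero one_ne_zero (2 * k - 4 * z) (by linear_combination -h)
  · exact PadicInt.mul_odd_ne_zero two_ne_zero (k - 2 * z) (by linear_combination -h)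
  · exact PadicInt.mul_odd_ne_zero one_ne_zero (1 + 2 * k - 4 * z) (by linear_combination -h)
  · exact PadicInt.mul_odd_ne_zero (m := 4) (by norm_num) (2 * k - z) (by linear_combination -h)
  obtain ⟨k, h4⟩ : 8 ∣ 3 * (2 * s) ^ 2 + 8 * a * (2 * s) + 16 * b :=
    h4.elim (fun h4 => dvd_trans ⟨2, by norm_num⟩ h4.2) And.right
  rcases PadicInt.even_or_odd s with ⟨t, rfl⟩ | ⟨t, rfl⟩
  swap
  · exact PadicInt.mul_odd_ne_zero (m := 4) (by norm_num)
      (6 * t ^ 2 + 6 * t + 1 + 2 * a * (2 * t + 1) + 2 * b - k) (by linear_combination h4)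
  -- `r = 4 t` makes it divisible by `64`
  rcases h with ⟨l, h⟩ | ⟨l, h⟩
  · exact PadicInt.mul_odd_ne_zero (m := 32) (by norm_num)
      (l - (t ^ 3 + a * t ^ 2 + b * t + c)) (by linear_combination -h + hz * 8)
  · exact PadicInt.mul_odd_ne_zero (m := 16) (by norm_num)
      (1 + 2 * l - 2 * (t ^ 3 + a * t ^ 2 + b * t + c)) (by linear_combination -h + hz * 8)

/-- The cubic `x³ + a x² + b x + c` has an integral translate by `r` which, rescaled by
`x ↦ 4 ^ k x`, is integral with exceptional coefficients. -/
def HasExceptionalModel (a b c : ℤ_[2]) : Prop :=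
  ∃ (k : ℕ) (r A₂ A₄ A₆ : ℤ_[2]), 3 * r + a = 4 ^ k * A₂ ∧
    3 * r ^ 2 + 2 * a * r + b = 16 ^ k * A₄ ∧
    r ^ 3 + a * r ^ 2 + b * r + c = 64 ^ k * A₆ ∧ IsExceptional A₂ A₄ A₆

/-- Separates the case in which no rescaling is needed from the others, of which only the
divisibilities are retained. -/
lemma HasExceptionalModel.exists_isExceptional_or_dvd {a b c : ℤ_[2]}
    (h : HasExceptionalModel a b c) :
    ∃ r, IsExceptional (3 * r + a) (3 * r ^ 2 + 2 * a * r + b) (r ^ 3 + a * r ^ 2 + b * r + c) ∨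
      (4 ∣ 3 * r + a ∧ 16 ∣ 3 * r ^ 2 + 2 * a * r + b ∧ 64 ∣ r ^ 3 + a * r ^ 2 + b * r + c) := by
  obtain ⟨k, r, A₂, A₄, A₆, h2, h4, h6, h⟩ := h
  refine ⟨r, ?_⟩
  rw [h2, h4, h6]
  rcases k with _ | k
  · simpa using Or.inl h
  · exact Or.inr ⟨⟨4 ^ k * A₂, by ring⟩, ⟨16 ^ k * A₄, by ring⟩, ⟨64 ^ k * A₆, by ring⟩⟩

/-- The converse of an evident implication: by minimality of exceptional cubics, the model `k = 0`
of the rescaled cubic is not exceptional, and for `k ≥ 1` the translation is divisible by `4`. -/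
lemma HasExceptionalModel.of_scaled {a b c : ℤ_[2]}
    (h : HasExceptionalModel (4 * a) (16 * b) (64 * c)) : HasExceptionalModel a b c := by
  obtain ⟨k, r, A₂, A₄, A₆, h2, h4, h6, h⟩ := h
  rcases k with _ | k
  · rw [pow_zero, one_mul] at h2 h4 h6
    refine absurd ?_ (not_isExceptional_of_scaled a b c r)
    rw [← h2, ← h4, ← h6] at h
    convert h using 1
    ring
  · obtain ⟨s, rfl⟩ : (4 : ℤ_[2]) ∣ r := by
      exact ⟨r + a - 4 ^ k * A₂, by linear_combination -h2⟩
    refine ⟨k, s, A₂, A₄, A₆, ?_, ?_, ?_, h⟩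
    · refine mul_left_cancel₀ (show (4 : ℤ_[2]) ≠ 0 by norm_num) ?_
      linear_combination h2
    · refine mul_left_cancel₀ (show (16 : ℤ_[2]) ≠ 0 by norm_num) ?_
      linear_combination h4
    · refine mul_left_cancel₀ (show (64 : ℤ_[2]) ≠ 0 by norm_num) ?_
      linear_combination h6

/-! ### From Kodaira types to exceptional models -/

/-- The scaling factor `u` of the change of variables cannot have negative valuation, by
`not_isExceptional_of_scaled`; its unit part is absorbed by `IsExceptional.unit_scale`. -/
lemma hasExceptionalModel_of_variableChange {a b c A₂ A₄ A₆ : ℤ_[2]} {u r : ℚ_[2]} (hu : u ≠ 0)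
    (h2 : u ^ 2 * algebraMap ℤ_[2] ℚ_[2] A₂ = algebraMap ℤ_[2] ℚ_[2] a + 3 * r)
    (h4 : u ^ 4 * algebraMap ℤ_[2] ℚ_[2] A₄ =
      algebraMap ℤ_[2] ℚ_[2] b + 2 * algebraMap ℤ_[2] ℚ_[2] a * r + 3 * r ^ 2)
    (h6 : u ^ 6 * algebraMap ℤ_[2] ℚ_[2] A₆ = algebraMap ℤ_[2] ℚ_[2] c +
      algebraMap ℤ_[2] ℚ_[2] b * r + algebraMap ℤ_[2] ℚ_[2] a * r ^ 2 + r ^ 3)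
    (h : IsExceptional A₂ A₄ A₆) : HasExceptionalModel a b c := by
  have hinj : Function.Injective (algebraMap ℤ_[2] ℚ_[2]) := Subtype.val_injective
  have hlift : ∀ x : ℚ_[2], ‖x‖ ≤ 1 → ∃ y, algebraMap ℤ_[2] ℚ_[2] y = x := fun x hx => ⟨⟨x, hx⟩, rfl⟩
  have hnorm : ∀ y, ‖algebraMap ℤ_[2] ℚ_[2] y‖ = ‖y‖ := fun y => rfl
  generalize algebraMap ℤ_[2] ℚ_[2] = φ at *
  obtain ⟨i, hi⟩ := PadicInt.isUnit_three.exists_right_inv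
  have hi' : 3 * φ i = 1 := by rw [← map_ofNat φ 3, ← map_mul, hi, map_one]
  rcases le_or_gt ‖u‖ 1 with hn | hn
  · obtain ⟨v, rfl⟩ := hlift u hn
    -- `r` is integral because `3` is a unit
    obtain ⟨s, rfl⟩ : ∃ s, φ s = r := ⟨i * (v ^ 2 * A₂ - a), by
      simp only [map_mul, map_sub, map_pow]
      linear_combination φ i * h2 + r * hi'⟩
    have hv : v ≠ 0 := by rintro rfl; simp at hu
    have h2' : v ^ 2 * A₂ = a + 3 * s := hinj (by
      simpa only [map_add, map_mul, map_pow, map_ofNat] using h2)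
    have h4' : v ^ 4 * A₄ = b + 2 * a * s + 3 * s ^ 2 := hinj (by
      simpa only [map_add, map_mul, map_pow, map_ofNat] using h4)
    have h6' : v ^ 6 * A₆ = c + b * s + a * s ^ 2 + s ^ 3 := hinj (by
      simpa only [map_add, map_mul, map_pow, map_ofNat] using h6)
    have hw := PadicInt.unitCoeff_spec hv
    generalize PadicInt.unitCoeff hv = w at hw
    generalize v.valuation = k at hw
    rw [Nat.cast_ofNat] at hw
    have p4 : (4 : ℤ_[2]) ^ k = (2 ^ k) ^ 2 := by rw [← pow_mul, mul_comm, pow_mul]; norm_num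
    have p16 : (16 : ℤ_[2]) ^ k = (2 ^ k) ^ 4 := by rw [← pow_mul, mul_comm, pow_mul]; norm_num
    have p64 : (64 : ℤ_[2]) ^ k = (2 ^ k) ^ 6 := by rw [← pow_mul, mul_comm, pow_mul]; norm_num
    rw [hw] at h2' h4' h6'
    refine ⟨k, s, _, _, _, ?_, ?_, ?_, h.unit_scale w⟩
    · rw [p4]; linear_combination -h2'
    · rw [p16]; linear_combination -h4'
    · rw [p64]; linear_combination -h6'
  · have hn' : ‖u⁻¹‖ < 1 := by rw [norm_inv]; exact inv_lt_one_of_one_lt₀ hn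
    obtain ⟨y, hy⟩ := hlift u⁻¹ hn'.le
    obtain ⟨z, rfl⟩ : (2 : ℤ_[2]) ∣ y := by
      simpa using (PadicInt.norm_lt_one_iff_dvd (p := 2) y).1 (by rw [← hnorm, hy]; exact hn')
    rw [map_mul, map_ofNat] at hy
    have hy1 : u * (2 * φ z) = 1 := by rw [hy, mul_inv_cancel₀ hu]
    have y2 : u ^ 2 * (2 * φ z) ^ 2 = 1 := by rw [← mul_pow, hy1, one_pow]
    have y4 : u ^ 4 * (2 * φ z) ^ 4 = 1 := by rw [← mul_pow, hy1, one_pow]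
    have y6 : u ^ 6 * (2 * φ z) ^ 6 = 1 := by rw [← mul_pow, hy1, one_pow]
    -- `s = r / u ^ 2` is again integral because `3` is a unit
    obtain ⟨s, hs⟩ : ∃ s, φ s = r * (2 * φ z) ^ 2 := ⟨i * (A₂ - a * (2 * z) ^ 2), by
      simp only [map_mul, map_sub, map_pow, map_ofNat]
      linear_combination φ i * (2 * φ z) ^ 2 * h2 - φ i * φ A₂ * y2 + r * (2 * φ z) ^ 2 * hi'⟩
    have h2' : A₂ = 3 * s + 4 * (a * z ^ 2) := hinj (by
      simp only [map_add, map_mul, map_pow, map_ofNat, hs]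
      linear_combination (2 * φ z) ^ 2 * h2 - φ A₂ * y2)
    have h4' : A₄ = 3 * s ^ 2 + 8 * (a * z ^ 2) * s + 16 * (b * z ^ 4) := hinj (by
      simp only [map_add, map_mul, map_pow, map_ofNat, hs]
      linear_combination (2 * φ z) ^ 4 * h4 - φ A₄ * y4)
    have h6' : A₆ = s ^ 3 + 4 * (a * z ^ 2) * s ^ 2 + 16 * (b * z ^ 4) * s + 64 * (c * z ^ 6) :=
      hinj (by
        simp only [map_add, map_mul, map_pow, map_ofNat, hs]
        linear_combination (2 * φ z) ^ 6 * h6 - φ A₆ * y6)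
    rw [h2', h4', h6'] at h
    exact absurd h (not_isExceptional_of_scaled _ _ _ _)

lemma hasExceptionalModel_of_hasKodairaTypeAt {W : WeierstrassCurve ℚ} {a b c : ℤ}
    (h₁ : W.a₁ = 0) (h₂ : W.a₂ = a) (h₃ : W.a₃ = 0) (h₄ : W.a₄ = b) (h₆ : W.a₆ = c)
    {T : KodairaType} (hT : T = .II ∨ T = .IIstar ∨ T = .IV ∨ T = .IVstar)
    (h : HasKodairaTypeAt W 2 T) : HasExceptionalModel a b c := by
  obtain ⟨C, W', hC, hW'⟩ := h
  obtain ⟨α, β, ha1, ha3, hA⟩ := TateStops.exists_isExceptional (W := W') (by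
    rcases hT with rfl | rfl | rfl | rfl
    exacts [Or.inl hW', Or.inr (Or.inl hW'), Or.inr (Or.inr (Or.inl hW')),
      Or.inr (Or.inr (Or.inr hW'))])
  have hu : (C.u : ℚ_[2]) * (C.u⁻¹ : ℚ_[2]ˣ) = 1 := C.u.mul_inv
  have e2 := congrArg WeierstrassCurve.b₂ hC
  have e4 := congrArg WeierstrassCurve.b₄ hC
  have e6 := congrArg WeierstrassCurve.b₆ hC
  rw [WeierstrassCurve.variableChange_b₂, WeierstrassCurve.map_b₂, WeierstrassCurve.map_b₂] at e2
  rw [WeierstrassCurve.variableChange_b₄, WeierstrassCurve.map_b₂, WeierstrassCurve.map_b₄,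
    WeierstrassCurve.map_b₄] at e4
  rw [WeierstrassCurve.variableChange_b₆, WeierstrassCurve.map_b₂, WeierstrassCurve.map_b₄,
    WeierstrassCurve.map_b₆, WeierstrassCurve.map_b₆] at e6
  simp only [WeierstrassCurve.b₂, WeierstrassCurve.b₄, WeierstrassCurve.b₆, h₁, h₂, h₃, h₄, h₆, ha1, ha3,
    map_add, map_mul, map_pow, map_ofNat, map_zero, map_intCast]
    at e2 e4 e6
  generalize (C.u : ℚ_[2]) = u at *
  generalize ((C.u⁻¹ : ℚ_[2]ˣ) : ℚ_[2]) = v at *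
  have y2 : u ^ 2 * v ^ 2 = 1 := by rw [← mul_pow, hu, one_pow]
  have y4 : u ^ 4 * v ^ 4 = 1 := by rw [← mul_pow, hu, one_pow]
  have y6 : u ^ 6 * v ^ 6 = 1 := by rw [← mul_pow, hu, one_pow]
  refine hasExceptionalModel_of_variableChange (u := u) (r := C.r) (left_ne_zero_of_mul_eq_one hu)
    ?_ ?_ ?_ hA
  · simp only [map_add, map_pow, map_intCast]
    linear_combination -(1 / 4) * u ^ 2 * e2 + (a + 3 * C.r) * y2
  · simp only [map_add, map_mul, map_ofNat, map_intCast]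
    linear_combination -(1 / 2) * u ^ 4 * e4 + (b + 2 * a * C.r + 3 * C.r ^ 2) * y4
  · simp only [map_add, map_pow, map_intCast]
    linear_combination -(1 / 4) * u ^ 6 * e6 + (c + b * C.r + a * C.r ^ 2 + C.r ^ 3) * y6

/-! ### Excluding exceptional models -/

/-- The trace modulo `16` of `IsExceptional`. A divisibility `2 ^ i ∣ x` becomes
`2 ^ (4 - i) * x = 0`, which is decidable by evaluation. -/
def IsExceptionalMod (A₂ A₄ A₆ : ZMod 16) : Prop :=
  8 * A₄ = 0 ∧ (4 * (A₆ - 1) = 0 ∨ 4 * (A₆ - 2) = 0 ∨ 4 * (A₆ - 3) = 0 ∨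
    (A₆ = 4 ∧ (4 * A₂ = 0 ∧ 2 * A₄ = 0 ∨ 4 * (A₂ - 1) = 0 ∧ 2 * (A₄ - 4) = 0)) ∨
    ((4 * A₂ = 0 ∧ A₄ = 0 ∨ 4 * (A₂ - 1) = 0 ∧ 2 * A₄ = 0) ∧ A₆ = 0))

/-- A necessary condition modulo `16` for `HasExceptionalModel`. -/
def HasExceptionalModelMod (a b c : ZMod 16) : Prop :=
  ∃ r, IsExceptionalMod (3 * r + a) (3 * r ^ 2 + 2 * a * r + b) (r ^ 3 + a * r ^ 2 + b * r + c) ∨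
    (4 * (3 * r + a) = 0 ∧ 3 * r ^ 2 + 2 * a * r + b = 0 ∧ r ^ 3 + a * r ^ 2 + b * r + c = 0)

instance (A₂ A₄ A₆ : ZMod 16) : Decidable (IsExceptionalMod A₂ A₄ A₆) :=
  inferInstanceAs (Decidable (_ ∧ _))

instance (a b c : ZMod 16) : Decidable (HasExceptionalModelMod a b c) :=
  inferInstanceAs (Decidable (∃ _, _))

lemma IsExceptional.mod {A₂ A₄ A₆ : ℤ_[2]} (h : IsExceptional A₂ A₄ A₆) (f : ℤ_[2] →+* ZMod 16) :
    IsExceptionalMod (f A₂) (f A₄) (f A₆) := by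
  have key : ∀ {m x : ℤ_[2]} (k : ZMod 16), m ∣ x → k * f m = 0 → k * f x = 0 := by
    rintro m x k ⟨y, rfl⟩ hk
    rw [map_mul, ← mul_assoc, hk, zero_mul]
  have key' : ∀ {m d x : ℤ_[2]} (k : ZMod 16), m ∣ x - d → k * f m = 0 → k * (f x - f d) = 0 :=
    fun k h hk => by rw [← map_sub]; exact key k h hk
  have f2 : f 2 = 2 := map_ofNat f 2
  have f3 : f 3 = 3 := map_ofNat f 3
  have f4 : f 4 = 4 := map_ofNat f 4
  have f8 : f 8 = 8 := map_ofNat f 8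
  have f16 : f 16 = 0 := map_ofNat f 16
  have f64 : f 64 = 0 := map_ofNat f 64
  obtain ⟨h2, h⟩ := h
  refine ⟨key 8 h2 (by rw [f2]; rfl), ?_⟩
  rcases h with h | h | h | ⟨h, h' | h'⟩ | ⟨h', h⟩
  · exact Or.inl (by simpa only [map_one] using key' 4 h (by rw [f4]; rfl))
  · exact Or.inr (Or.inl (by simpa only [f2] using key' 4 h (by rw [f4]; rfl)))
  · exact Or.inr (Or.inr (Or.inl (by simpa only [f3] using key' 4 h (by rw [f4]; rfl))))
  · refine Or.inr (Or.inr (Or.inr (Or.inl ⟨?_, Or.inl ⟨key 4 h'.1 (by rw [f4]; rfl),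
      key 2 h'.2 (by rw [f8]; rfl)⟩⟩)))
    simpa only [f4, one_mul, sub_eq_zero] using key' 1 h (by rw [f16]; rfl)
  · refine Or.inr (Or.inr (Or.inr (Or.inl ⟨?_, Or.inr ⟨?_, ?_⟩⟩)))
    · simpa only [f4, one_mul, sub_eq_zero] using key' 1 h (by rw [f16]; rfl)
    · simpa only [map_one] using key' 4 h'.1 (by rw [f4]; rfl)
    · simpa only [f4] using key' 2 h'.2 (by rw [f8]; rfl)
  · refine Or.inr (Or.inr (Or.inr (Or.inr ⟨h'.imp (fun h' => ⟨?_, ?_⟩) fun h' => ⟨?_, ?_⟩, ?_⟩)))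
    · exact key 4 h'.1 (by rw [f4]; rfl)
    · simpa only [one_mul] using key 1 h'.2 (by rw [f16]; rfl)
    · simpa only [map_one] using key' 4 h'.1 (by rw [f4]; rfl)
    · exact key 2 h'.2 (by rw [f8]; rfl)
    · -- `32` and `48` both vanish modulo `16`
      have f32 : f 32 = 0 := map_ofNat f 32
      have f48 : f 48 = 0 := map_ofNat f 48
      rcases h with h | h
      · simpa only [f32, one_mul, sub_zero] using key' 1 h (by rw [f64]; rfl)
      · simpa only [f48, one_mul, sub_zero] using key' 1 h (by rw [f64]; rfl)

lemma HasExceptionalModel.mod {a b c : ℤ_[2]} (h : HasExceptionalModel a b c)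
    (f : ℤ_[2] →+* ZMod 16) : HasExceptionalModelMod (f a) (f b) (f c) := by
  obtain ⟨r, h⟩ := h.exists_isExceptional_or_dvd
  have e2 : 3 * f r + f a = f (3 * r + a) := by simp only [map_add, map_mul, map_ofNat]
  have e4 : 3 * f r ^ 2 + 2 * f a * f r + f b = f (3 * r ^ 2 + 2 * a * r + b) := by
    simp only [map_add, map_mul, map_pow, map_ofNat]
  have e6 : f r ^ 3 + f a * f r ^ 2 + f b * f r + f c = f (r ^ 3 + a * r ^ 2 + b * r + c) := by
    simp only [map_add, map_mul, map_pow]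
  refine ⟨f r, ?_⟩
  rw [e2, e4, e6]
  refine h.imp (fun h => h.mod f) fun ⟨⟨x, hx⟩, ⟨y, hy⟩, ⟨z, hz⟩⟩ => ?_
  have h16 : (16 : ZMod 16) = 0 := rfl
  rw [hx, hy, hz, map_mul, map_mul, map_mul, map_ofNat, map_ofNat, map_ofNat]
  exact ⟨by linear_combination f x * h16, by linear_combination f y * h16,
    by linear_combination 4 * f z * h16⟩

lemma HasExceptionalModel.intCast_mod {a b c : ℤ} (h : HasExceptionalModel a b c) :
    HasExceptionalModelMod a b c := by
  have f : ℤ_[2] →+* ZMod 16 := PadicInt.toZModPow 4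
  simpa only [map_intCast] using h.mod f

lemma not_hasExceptionalModel_of_two_mul_odd (a b c : ℤ_[2]) :
    ¬ HasExceptionalModel a (2 * (2 * b + 1)) (4 * c) := by
  intro h
  obtain ⟨r, h⟩ := h.exists_isExceptional_or_dvd
  -- the linear coefficient is even, hence `r` is even and that coefficient is `2` modulo `4`
  obtain ⟨e, he⟩ : 2 ∣ 3 * r ^ 2 + 2 * a * r + 2 * (2 * b + 1) :=
    h.elim And.left fun h => dvd_trans ⟨8, by norm_num⟩ h.2.1
  rcases PadicInt.even_or_odd r with ⟨s, rfl⟩ | ⟨s, rfl⟩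
  swap
  · exact PadicInt.mul_odd_ne_zero one_ne_zero
      (6 * s ^ 2 + 6 * s + 1 + a * (2 * s + 1) + (2 * b + 1) - e) (by linear_combination he)
  have h4 : ¬ 4 ∣ 3 * (2 * s) ^ 2 + 2 * a * (2 * s) + 2 * (2 * b + 1) := fun ⟨k, hk⟩ =>
    PadicInt.mul_odd_ne_zero two_ne_zero (3 * s ^ 2 + a * s + b - k) (by linear_combination hk)
  set z := 2 * s ^ 3 + a * s ^ 2 + (2 * b + 1) * s + c with hz
  have h6 : (2 * s) ^ 3 + a * (2 * s) ^ 2 + 2 * (2 * b + 1) * (2 * s) + 4 * c = 4 * z := by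
    rw [hz]; ring
  rw [h6] at h
  rcases h with ⟨-, ⟨k, h⟩ | ⟨k, h⟩ | ⟨k, h⟩ | ⟨-, h | h⟩ | ⟨h | h, -⟩⟩ | h
  · exact PadicInt.mul_odd_ne_zero one_ne_zero (2 * k - 2 * z) (by linear_combination -h)
  · exact PadicInt.mul_odd_ne_zero two_ne_zero (k - z) (by linear_combination -h)
  · exact PadicInt.mul_odd_ne_zero one_ne_zero (1 + 2 * k - 2 * z) (by linear_combination -h)
  · exact h4 (dvd_trans ⟨2, by norm_num⟩ h.2)
  · exact h4 ((dvd_sub_self_right).1 (dvd_trans ⟨2, by norm_num⟩ h.2))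
  · exact h4 (dvd_trans ⟨4, by norm_num⟩ h.2)
  · exact h4 (dvd_trans ⟨2, by norm_num⟩ h.2)
  · exact h4 (dvd_trans ⟨4, by norm_num⟩ h.2.1)

/-- The case of `H` after one rescaling, when `q` is `5` modulo `8`. -/
lemma not_hasExceptionalModel_of_odd (a b : ℤ_[2]) :
    ¬ HasExceptionalModel (2 * a + 1) (4 * (2 * b + 1)) 0 := by
  have check : ∀ x : ZMod 16, 8 * (x - 1) = 0 →
      ¬ HasExceptionalModelMod x 4 0 ∧ ¬ HasExceptionalModelMod x 12 0 := by decide +kernel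
  intro h
  have f : ℤ_[2] →+* ZMod 16 := PadicInt.toZModPow 4
  have h16 : (16 : ZMod 16) = 0 := rfl
  have hf := h.mod f
  simp only [map_add, map_mul, map_ofNat, map_one, map_zero] at hf
  obtain ⟨h4, h12⟩ := check (2 * f a + 1) (by linear_combination f a * h16)
  rcases PadicInt.even_or_odd b with ⟨d, rfl⟩ | ⟨d, rfl⟩
  · refine h4 ?_
    convert hf using 1
    rw [map_mul, map_ofNat]
    linear_combination -f d * h16
  · refine h12 ?_
    convert hf using 1
    rw [map_add, map_mul, map_ofNat, map_one]
    linear_combination -f d * h16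

/-- The case of `H` after one rescaling, when `q` is `1` modulo `16`; a second rescaling is possible
when `a` is even. -/
lemma not_hasExceptionalModel_of_even (a b : ℤ_[2]) :
    ¬ HasExceptionalModel (2 * a) (32 * (2 * b + 1)) 0 := by
  have check : ∀ x : ZMod 16, 4 * (x - 2) = 0 → ¬ HasExceptionalModelMod x 0 0 := by
    decide +kernel
  intro h
  rcases PadicInt.even_or_odd a with ⟨d, rfl⟩ | ⟨d, rfl⟩
  · refine not_hasExceptionalModel_of_two_mul_odd d b 0 (HasExceptionalModel.of_scaled ?_)
    convert h using 1 <;> ring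
  · have f : ℤ_[2] →+* ZMod 16 := PadicInt.toZModPow 4
    have h16 : (16 : ZMod 16) = 0 := rfl
    have hf := h.mod f
    simp only [map_add, map_mul, map_ofNat, map_one, map_zero] at hf
    refine check (2 * (2 * f d + 1)) (by linear_combination f d * h16) ?_
    convert hf using 1
    linear_combination -2 * (2 * f b + 1) * h16

/-! ### The two families -/

lemma ZMod.four_mul_sub_eq_zero {x n : ℤ} (h : x ≡ n [ZMOD 4]) :
    4 * ((x : ZMod 16) - n) = 0 := by
  obtain ⟨k, hk⟩ := h.symm.dvd
  have h16 : (16 : ZMod 16) = 0 := rfl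
  rw [← Int.cast_sub, hk]
  push_cast
  linear_combination (k : ZMod 16) * h16

/-- The hypotheses on `(q, t)`, apart from the exclusion of `(12, 0)`. -/
def IsAdmissible (q t : ℤ) : Prop :=
  (q ≡ 3 [ZMOD 4] ∧ t ≡ 3 [ZMOD 4]) ∨
    ((q ≡ 1 [ZMOD 16] ∨ q ≡ 5 [ZMOD 16] ∨ q ≡ 13 [ZMOD 16]) ∧ t ≡ 1 [ZMOD 8]) ∨
    (q = 8 ∨ q = 10 ∨ q = 12)

lemma not_hasExceptionalModel_curveE {q t : ℤ} (h : IsAdmissible q t) :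
    ¬ HasExceptionalModel ((q ^ 2 : ℤ) : ℤ_[2]) ((3 * q ^ 3 : ℤ) : ℤ_[2])
      ((3 * q ^ 6 * t : ℤ) : ℤ_[2]) := by
  have check₁ : ∀ q t : ZMod 16, 4 * (q - 3) = 0 → 4 * (t - 3) = 0 →
      ¬ HasExceptionalModelMod (q ^ 2) (3 * q ^ 3) (3 * q ^ 6 * t) := by decide +kernel
  have check₂ : ∀ q t : ZMod 16, (q = 1 ∨ q = 5 ∨ q = 13) → 2 * (t - 1) = 0 →
      ¬ HasExceptionalModelMod (q ^ 2) (3 * q ^ 3) (3 * q ^ 6 * t) := by decide +kernel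
  have check₁₀ : ∀ t : ZMod 16,
      ¬ HasExceptionalModelMod (10 ^ 2) (3 * 10 ^ 3) (3 * 10 ^ 6 * t) := by decide +kernel
  have check₁₂ : ∀ t : ZMod 16, ¬ HasExceptionalModelMod 36 324 (64 * t) := by decide +kernel
  intro hm
  have hmod := hm.intCast_mod
  rcases h with ⟨hq, ht⟩ | ⟨hq, ht⟩ | rfl | rfl | rfl
  · push_cast at hmod
    exact check₁ q t (by exact_mod_cast ZMod.four_mul_sub_eq_zero hq)
      (by exact_mod_cast ZMod.four_mul_sub_eq_zero ht) hmod
  · push_cast at hmod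
    refine check₂ q t ?_ ?_ hmod
    · refine hq.imp (fun h => ?_) (Or.imp (fun h => ?_) fun h => ?_)
      · exact_mod_cast (ZMod.intCast_eq_intCast_iff q 1 16).2 h
      · exact_mod_cast (ZMod.intCast_eq_intCast_iff q 5 16).2 h
      · exact_mod_cast (ZMod.intCast_eq_intCast_iff q 13 16).2 h
    · obtain ⟨k, hk⟩ := ht.symm.dvd
      obtain rfl : t = 8 * k + 1 := by omega
      have h16 : (16 : ZMod 16) = 0 := rfl
      push_cast
      linear_combination (k : ZMod 16) * h16
  · -- for `q = 8` two rescalings are possible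
    refine not_hasExceptionalModel_of_two_mul_odd 4 1 (48 * t)
      (HasExceptionalModel.of_scaled (HasExceptionalModel.of_scaled ?_))
    convert hm using 1 <;> push_cast <;> ring
  · push_cast at hmod
    exact check₁₀ t hmod
  · -- for `q = 12` one rescaling is possible
    have hs : HasExceptionalModel ((36 : ℤ) : ℤ_[2]) ((324 : ℤ) : ℤ_[2])
        ((64 * (2187 * t) : ℤ) : ℤ_[2]) := by
      refine HasExceptionalModel.of_scaled ?_
      convert hm using 1 <;> push_cast <;> ring
    refine check₁₂ (2187 * t) ?_
    have := hs.intCast_mod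
    push_cast at this
    exact this

lemma not_hasExceptionalModel_curveH {q t : ℤ} (h : IsAdmissible q t) :
    ¬ HasExceptionalModel ((q * (27 - 2 * q - 81 * q * t) : ℤ) : ℤ_[2])
      ((q * (q - 9) ^ 3 : ℤ) : ℤ_[2]) ((0 : ℤ) : ℤ_[2]) := by
  have check₁ : ∀ q t : ZMod 16, 4 * (q - 3) = 0 → 4 * (t - 3) = 0 →
      ¬ HasExceptionalModelMod (q * (27 - 2 * q - 81 * q * t)) (q * (q - 9) ^ 3) 0 := by
    decide +kernel
  have check₂ : ∀ q t : ZMod 16, (q = 8 ∨ q = 10 ∨ q = 12) →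
      ¬ HasExceptionalModelMod (q * (27 - 2 * q - 81 * q * t)) (q * (q - 9) ^ 3) 0 := by
    decide +kernel
  have five_mod_eight : q ≡ 5 [ZMOD 8] → t ≡ 1 [ZMOD 8] →
      ¬ HasExceptionalModel ((q * (27 - 2 * q - 81 * q * t) : ℤ) : ℤ_[2])
        ((q * (q - 9) ^ 3 : ℤ) : ℤ_[2]) ((0 : ℤ) : ℤ_[2]) := by
    intro hq ht hm
    obtain ⟨s, hs⟩ := hq.symm.dvd
    obtain ⟨m, hm'⟩ := ht.symm.dvd
    obtain rfl : q = 8 * s + 5 := by omega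
    obtain rfl : t = 8 * m + 1 := by omega
    -- `a₂ = 4 x` and `a₄ = 64 y` with `x` and `y` odd
    obtain ⟨x, hx⟩ : Odd ((8 * s + 5) * (-97 - 4 * s - 162 * (5 * m + s + 8 * s * m))) := by
      refine Odd.mul ⟨4 * s + 2, by ring⟩
        ⟨-49 - 2 * s - 81 * (5 * m + s + 8 * s * m), by ring⟩
    obtain ⟨y, hy⟩ : Odd ((8 * s + 5) * (2 * s - 1) ^ 3) :=
      Odd.mul ⟨4 * s + 2, by ring⟩ (Odd.pow ⟨s - 1, by ring⟩)
    refine not_hasExceptionalModel_of_odd x y (HasExceptionalModel.of_scaled ?_)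
    convert hm using 1
    · have := congrArg (fun n : ℤ => (4 * n : ℤ_[2])) hx
      push_cast at this ⊢
      linear_combination -this
    · have := congrArg (fun n : ℤ => (64 * n : ℤ_[2])) hy
      push_cast at this ⊢
      linear_combination -this
    · simp
  intro hm
  rcases h with ⟨hq, ht⟩ | ⟨hq | hq | hq, ht⟩ | hq
  · have hmod := hm.intCast_mod
    push_cast at hmod
    exact check₁ q t (by exact_mod_cast ZMod.four_mul_sub_eq_zero hq)
      (by exact_mod_cast ZMod.four_mul_sub_eq_zero ht) hmod
  · obtain ⟨s, hs⟩ := hq.symm.dvd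
    obtain ⟨m, hm'⟩ := ht.symm.dvd
    obtain rfl : q = 16 * s + 1 := by omega
    obtain rfl : t = 8 * m + 1 := by omega
    -- `a₂` is divisible by `8` and `a₄ = 512 y` with `y` odd
    obtain ⟨y, hy⟩ : Odd ((16 * s + 1) * (2 * s - 1) ^ 3) :=
      Odd.mul ⟨8 * s, by ring⟩ (Odd.pow ⟨s - 1, by ring⟩)
    refine not_hasExceptionalModel_of_even
      ((16 * s + 1) * (-7 - 4 * s - 81 * (2 * s + m + 16 * s * m))) y
      (HasExceptionalModel.of_scaled ?_)
    convert hm using 1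
    · push_cast; ring
    · have := congrArg (fun n : ℤ => (512 * n : ℤ_[2])) hy
      push_cast at this ⊢
      linear_combination -this
    · simp
  · exact five_mod_eight (hq.of_dvd (by norm_num)) ht hm
  · exact five_mod_eight ((hq.of_dvd (by norm_num)).trans (by decide)) ht hm
  · have hmod := hm.intCast_mod
    push_cast at hmod
    refine check₂ q t ?_ hmod
    rcases hq with rfl | rfl | rfl <;> decide

/-! ### Nonsingularity -/

/-- The factor of the discriminants of both curves that depends on `t`: `Δ(E) = -48 q⁹ D` and
`Δ(H) = 1296 q³ (q - 9)⁶ D`. -/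
def discFactor {R : Type*} [CommRing R] (q t : R) : R :=
  81 * q ^ 3 * t ^ 2 + (4 * q ^ 3 - 54 * q ^ 2) * t + 36 - 3 * q

lemma Int.sq_ne_two_mul_sq_mul_odd (M N y : ℤ) (hN : N ≠ 0) :
    M ^ 2 ≠ N ^ 2 * (2 * (2 * y + 1)) := by
  intro h
  obtain ⟨K, rfl⟩ : N ∣ M := (Int.pow_dvd_pow_iff two_ne_zero).1 ⟨_, h⟩
  have hK : K ^ 2 = 2 * (2 * y + 1) :=
    mul_left_cancel₀ (pow_ne_zero 2 hN) (by rw [← h]; ring)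
  rcases Int.even_or_odd' K with ⟨k, rfl | rfl⟩ <;> ring_nf at hK <;> omega

/-- As a quadratic in `t`, the form `discFactor` has discriminant `16 (q (q - 9))³`; this has odd
`2`-adic valuation if `q` is `3` modulo `4` or `1` modulo `16`. If `q` is `5` modulo `8`, the form
itself is nonzero modulo `32`. -/
lemma discFactor_ne_zero {q t : ℤ} (h : IsAdmissible q t) (hns : ¬ (q = 12 ∧ t = 0)) :
    discFactor q t ≠ 0 := by
  intro hD
  have five_mod_eight : q ≡ 5 [ZMOD 8] → t ≡ 1 [ZMOD 8] → False := by
    have check : ∀ q t : ZMod 32, 4 * (q - 5) = 0 → 4 * (t - 1) = 0 → discFactor q t ≠ 0 := by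
      unfold discFactor
      decide +kernel
    intro hq ht
    have h32 : (32 : ZMod 32) = 0 := rfl
    obtain ⟨s, hs⟩ := hq.symm.dvd
    obtain ⟨m, hm⟩ := ht.symm.dvd
    obtain rfl : q = 8 * s + 5 := by omega
    obtain rfl : t = 8 * m + 1 := by omega
    refine check ((8 * s + 5 : ℤ) : ZMod 32) ((8 * m + 1 : ℤ) : ZMod 32) ?_ ?_ ?_
    · push_cast; linear_combination (s : ZMod 32) * h32
    · push_cast; linear_combination (m : ZMod 32) * h32
    · have := congrArg (Int.cast : ℤ → ZMod 32) hD
      unfold discFactor at this ⊢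
      exact_mod_cast this
  have hsq : (162 * q ^ 3 * t + 4 * q ^ 3 - 54 * q ^ 2) ^ 2 = 16 * (q * (q - 9)) ^ 3 := by
    unfold discFactor at hD
    linear_combination 324 * q ^ 3 * hD
  rcases h with ⟨hq, ht⟩ | ⟨hq | hq | hq, ht⟩ | rfl | rfl | rfl
  · obtain ⟨s, hs⟩ := hq.symm.dvd
    obtain rfl : q = 4 * s + 3 := by omega
    obtain ⟨y, hy⟩ : Odd (((4 * s + 3) * (2 * s - 3)) ^ 3) :=
      (Odd.mul ⟨2 * s + 1, by ring⟩ ⟨s - 2, by ring⟩).pow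
    refine Int.sq_ne_two_mul_sq_mul_odd _ 8 y (by norm_num) (hsq.trans ?_)
    rw [← hy]; ring
  · obtain ⟨s, hs⟩ := hq.symm.dvd
    obtain rfl : q = 16 * s + 1 := by omega
    obtain ⟨y, hy⟩ : Odd (((16 * s + 1) * (2 * s - 1)) ^ 3) :=
      (Odd.mul ⟨8 * s, by ring⟩ ⟨s - 1, by ring⟩).pow
    refine Int.sq_ne_two_mul_sq_mul_odd _ 64 y (by norm_num) (hsq.trans ?_)
    rw [← hy]; ring
  · exact five_mod_eight (hq.of_dvd (by norm_num)) ht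
  · exact five_mod_eight ((hq.of_dvd (by norm_num)).trans (by decide)) ht
  · unfold discFactor at hD; omega
  · unfold discFactor at hD; omega
  · have : t * (864 * (162 * t - 1)) = 0 := by
      unfold discFactor at hD; linear_combination hD
    rcases mul_eq_zero.1 this with ht | ht
    · exact hns ⟨rfl, ht⟩
    · omega

lemma IsAdmissible.ne_zero_and_ne_nine {q t : ℤ} (h : IsAdmissible q t) : q ≠ 0 ∧ q ≠ 9 := by
  unfold IsAdmissible Int.ModEq at h
  omega

lemma isElliptic_curveE {q t : ℤ} (h : IsAdmissible q t) (hns : ¬ (q = 12 ∧ t = 0)) :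
    (curveE q t).IsElliptic := by
  have hΔ : (curveE q t).Δ = -48 * (q : ℚ) ^ 9 * (discFactor q t : ℤ) := by
    simp only [curveE, WeierstrassCurve.Δ, WeierstrassCurve.b₂, WeierstrassCurve.b₄,
      WeierstrassCurve.b₆, WeierstrassCurve.b₈, discFactor]
    push_cast
    ring
  have hq : (q : ℚ) ≠ 0 := by exact_mod_cast h.ne_zero_and_ne_nine.1
  have hD : ((discFactor q t : ℤ) : ℚ) ≠ 0 := by exact_mod_cast discFactor_ne_zero h hns
  rw [WeierstrassCurve.isElliptic_iff, hΔ, isUnit_iff_ne_zero]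
  exact mul_ne_zero (mul_ne_zero (by norm_num) (pow_ne_zero 9 hq)) hD

lemma isElliptic_curveH {q t : ℤ} (h : IsAdmissible q t) (hns : ¬ (q = 12 ∧ t = 0)) :
    (curveH q t).IsElliptic := by
  have hΔ : (curveH q t).Δ =
      1296 * (q : ℚ) ^ 3 * ((q : ℚ) - 9) ^ 6 * (discFactor q t : ℤ) := by
    simp only [curveH, WeierstrassCurve.Δ, WeierstrassCurve.b₂, WeierstrassCurve.b₄,
      WeierstrassCurve.b₆, WeierstrassCurve.b₈, discFactor]
    push_cast
    ring
  have hq : (q : ℚ) ≠ 0 := by exact_mod_cast h.ne_zero_and_ne_nine.1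
  have hq9 : (q : ℚ) - 9 ≠ 0 := sub_ne_zero.2 (by exact_mod_cast h.ne_zero_and_ne_nine.2)
  have hD : ((discFactor q t : ℤ) : ℚ) ≠ 0 := by exact_mod_cast discFactor_ne_zero h hns
  rw [WeierstrassCurve.isElliptic_iff, hΔ, isUnit_iff_ne_zero]
  exact mul_ne_zero
    (mul_ne_zero (mul_ne_zero (by norm_num) (pow_ne_zero 3 hq)) (pow_ne_zero 6 hq9)) hD

theorem mainTheorem7 (q t : ℤ)
    (hqt : (q ≡ 3 [ZMOD 4] ∧ t ≡ 3 [ZMOD 4]) ∨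
      ((q ≡ 1 [ZMOD 16] ∨ q ≡ 5 [ZMOD 16] ∨ q ≡ 13 [ZMOD 16]) ∧ t ≡ 1 [ZMOD 8]) ∨
      (q = 8 ∨ q = 10 ∨ q = 12))
    (hns : ¬ (q = 12 ∧ t = 0)) :
    ((curveE q t).IsElliptic ∧
      ¬ HasKodairaTypeAt (curveE q t) 2 .II ∧ ¬ HasKodairaTypeAt (curveE q t) 2 .IIstar ∧
      ¬ HasKodairaTypeAt (curveE q t) 2 .IV ∧ ¬ HasKodairaTypeAt (curveE q t) 2 .IVstar) ∧
    ((curveH q t).IsElliptic ∧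
      ¬ HasKodairaTypeAt (curveH q t) 2 .II ∧ ¬ HasKodairaTypeAt (curveH q t) 2 .IIstar ∧
      ¬ HasKodairaTypeAt (curveH q t) 2 .IV ∧ ¬ HasKodairaTypeAt (curveH q t) 2 .IVstar) := by
  have hE : ∀ T : KodairaType, (T = .II ∨ T = .IIstar ∨ T = .IV ∨ T = .IVstar) →
      ¬ HasKodairaTypeAt (curveE q t) 2 T := fun T hT h =>
    not_hasExceptionalModel_curveE hqt (hasExceptionalModel_of_hasKodairaTypeAt rfl
      (by simp [curveE]) rfl (by simp [curveE]) (by simp [curveE]) hT h)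
  have hH : ∀ T : KodairaType, (T = .II ∨ T = .IIstar ∨ T = .IV ∨ T = .IVstar) →
      ¬ HasKodairaTypeAt (curveH q t) 2 T := fun T hT h =>
    not_hasExceptionalModel_curveH hqt (hasExceptionalModel_of_hasKodairaTypeAt rfl
      (by simp [curveH]) rfl (by simp [curveH]) (by simp [curveH]) hT h)
  exact ⟨⟨isElliptic_curveE hqt hns, hE _ (by simp), hE _ (by simp), hE _ (by simp),
      hE _ (by simp)⟩,
    ⟨isElliptic_curveH hqt hns, hH _ (by simp), hH _ (by simp), hH _ (by simp), hH _ (by simp)⟩⟩
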